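/- Let $n \ge 3$. There is a constant $c_n \in (0,\infty)$, depending only on $n$, such that for every bounded open set $\Omega \subset \mathbb{R}^n$ and every real-valued $u \in C^2(\Omega) \cap C(\overline{\Omega})$, $$ \sup_{x\in\Omega} |u(x)| \;\le\; \sup_{x\in\partial\Omega} |u(x)| + c_n\, \|\Delta u\|_{L^{n/2,1}(\Omega)}. $$ Here $\|f\|_{L^{p,q}(\Omega)} = \left(\int_0^\infty \left(t^{1/p} f^*(t)\right)^q \frac{dt}{t}\right)^{1/q} \in [0,\infty]$ for $0<p,q<\infty$ denotes the Lorentz (quasi-)norm, where $f^*(t) = \inf\{ s \ge 0 : |\{x\in\Omega : |f(x)|>s\}| \le t\}$ is the decreasing rearrangement of $f$ with respect to Lebesgue measure. The suprema are taken in $[0,\infty]$, and the inequality is trivially true if the right-hand side is infinite. -/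

import Mathlib

open MeasureTheory
open scoped ENNReal NNReal

/-- The decreasing rearrangement `f*(t) = inf {s ≥ 0 : μ {x : |f x| > s} ≤ t}`, with values in
`[0, ∞]` (the infimum of a set that contains no finite `s` is `∞`). -/
noncomputable def decreasingRearrangement {α : Type*} [MeasurableSpace α]
    (f : α → ℝ) (μ : Measure α) (t : ℝ) : ℝ≥0∞ :=
  sInf {s : ℝ≥0∞ | μ {x | s < ‖f x‖ₑ} ≤ ENNReal.ofReal t}

/-- The Lorentz (quasi-)norm
`‖f‖_{L^{p,q}(μ)} = (∫_0^∞ (t^{1/p} f*(t))^q dt/t)^{1/q}`, for `0 < p < ∞` and `0 < q < ∞`,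
with values in `[0, ∞]`. -/
noncomputable def lorentzNorm {α : Type*} [MeasurableSpace α]
    (f : α → ℝ) (p q : ℝ) (μ : Measure α) : ℝ≥0∞ :=
  (∫⁻ t in Set.Ioi (0 : ℝ),
    (ENNReal.ofReal (t ^ (1 / p)) * decreasingRearrangement f μ t) ^ q / ENNReal.ofReal t) ^ (1 / q)

/-! Up to a constant, `u` is dominated on Ω by its boundary maximum plus a Newtonian potential of
|Δu|, and that potential is bounded by duality.

Duality: the kernel |x - y|^(2-n) lies in weak L^(n/(n-2)), uniformly in x, and n/2 is the conjugate
exponent, so its integral against f is at most a constant times the L^(n/2,1) norm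
(`lintegral_mul_le_lorentzNorm`).

Comparison: the kernel is regularized to (|x - y|² + ε²)^((2-n)/2), which is smaller, so the same
bound holds for every ε. Minus the Laplacian of the regularized potential w is the integral of f
against an explicit positive kernel, and for suitable ε it is at least κ(f - η)
(`exists_le_integral_kernel`). With f a cutoff of |Δu|, the function u - w/κ + ρ|y|² has positive
Laplacian where f = |Δu|, so the maximum principle applies (`sub_le_of_potential_bound`). Only this
one-sided inequality is used: κ need not be sharp, the equation for the singular potential is not
needed, and second derivatives along lines suffice. -/

open Filter Topology

/-! ### Lorentz norms and weak-type duality. -/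

/-- The integral of a function of weak type `p > 1` over a set of finite measure. -/
theorem setLIntegral_le_of_weak_type {α : Type*} [MeasurableSpace α] {μ : Measure α}
    {k : α → ℝ} (hk : Measurable k) (hk0 : ∀ y, 0 ≤ k y) {p : ℝ} (hp : 1 < p) {W : ℝ}
    (hW : 0 ≤ W) (hweak : ∀ s : ℝ, 0 < s → μ {y | s < k y} ≤ ENNReal.ofReal (W * s ^ (-p)))
    {A : Set α} (hA : μ A ≠ ∞) :
    ∫⁻ y in A, ENNReal.ofReal (k y) ∂μ ≤
      ENNReal.ofReal (1 + W / (p - 1)) * μ A ^ (1 - 1 / p) := by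
  rcases eq_or_ne (μ A) 0 with h0 | h0
  · rw [Measure.restrict_eq_zero.2 h0]; simp
  obtain ⟨a, ha, haA⟩ : ∃ a : ℝ, 0 < a ∧ μ A = ENNReal.ofReal a :=
    ⟨(μ A).toReal, ENNReal.toReal_pos h0 hA, (ENNReal.ofReal_toReal hA).symm⟩
  have hp0 : 0 < p := by linarith
  have hp1 : 0 < p - 1 := by linarith
  -- Splitting the layer-cake integral here makes both pieces multiples of a^(1 - 1/p): below s the
  -- trivial bound μ A is used, above s the weak-type bound.
  set s : ℝ := a ^ (-(1 / p)) with hs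
  have hs0 : 0 < s := Real.rpow_pos_of_pos ha _
  rw [lintegral_eq_lintegral_meas_lt _ (Filter.Eventually.of_forall hk0) hk.aemeasurable,
    ← Set.Ioc_union_Ioi_eq_Ioi hs0.le,
    lintegral_union measurableSet_Ioi (Set.Ioc_disjoint_Ioi le_rfl)]
  have h1 : ∫⁻ t in Set.Ioc 0 s, (μ.restrict A) {y | t < k y} ≤ ENNReal.ofReal (a * s) := by
    calc _ ≤ ∫⁻ t in Set.Ioc 0 s, μ A := by
          refine lintegral_mono fun t => ?_
          exact (measure_mono (Set.subset_univ _)).trans (by simp)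
      _ = _ := by
          rw [setLIntegral_const, haA, Real.volume_Ioc, sub_zero, ENNReal.ofReal_mul ha.le]
  have h2 : ∫⁻ t in Set.Ioi s, (μ.restrict A) {y | t < k y} ≤
      ENNReal.ofReal (W * (s ^ (1 - p) / (p - 1))) := by
    calc _ ≤ ∫⁻ t in Set.Ioi s, ENNReal.ofReal (W * t ^ (-p)) := by
          refine setLIntegral_mono' measurableSet_Ioi fun t ht => ?_
          exact (Measure.restrict_apply_le _ _).trans (hweak t (hs0.trans ht))
      _ = ENNReal.ofReal (∫ t in Set.Ioi s, W * t ^ (-p)) := by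
          rw [ofReal_integral_eq_lintegral_ofReal]
          · exact (integrableOn_Ioi_rpow_of_lt (by linarith) hs0).const_mul W
          · filter_upwards [ae_restrict_mem measurableSet_Ioi] with t ht
            exact mul_nonneg hW (Real.rpow_nonneg (hs0.trans ht).le _)
      _ = _ := by
          rw [integral_const_mul, integral_Ioi_rpow_of_lt (by linarith) hs0]
          congr 2
          rw [show -p + 1 = -(p - 1) by ring, neg_div_neg_eq, neg_sub]
  refine (add_le_add h1 h2).trans (le_of_eq ?_)
  rw [haA, ENNReal.ofReal_rpow_of_pos ha, ← ENNReal.ofReal_add (by positivity)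
    (by have := Real.rpow_nonneg hs0.le (1 - p); positivity), ← ENNReal.ofReal_mul (by positivity)]
  congr 1
  have e1 : a * s = a ^ (1 - 1 / p) := by
    rw [hs, sub_eq_add_neg, Real.rpow_add ha, Real.rpow_one]
  have e2 : s ^ (1 - p) = a ^ (1 - 1 / p) := by
    rw [hs, ← Real.rpow_mul ha.le]; congr 1; field_simp; ring
  rw [e1, e2]; ring

theorem measure_lt_le_of_decreasingRearrangement_lt {α : Type*} [MeasurableSpace α]
    {g : α → ℝ} {μ : Measure α} {t : ℝ} {s : ℝ≥0∞} (h : decreasingRearrangement g μ t < s) :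
    μ {x | s < ‖g x‖ₑ} ≤ ENNReal.ofReal t := by
  obtain ⟨r, hr, hrs⟩ := sInf_lt_iff.1 h
  exact (measure_mono fun x hx => hrs.trans hx).trans hr

theorem volume_setOf_ofReal_le_le (b : ℝ≥0∞) :
    volume {s : ℝ | 0 < s ∧ ENNReal.ofReal s ≤ b} ≤ b := by
  rcases eq_or_ne b ∞ with rfl | hb
  · exact le_top
  · calc _ ≤ volume (Set.Ioc 0 b.toReal) :=
          measure_mono fun s hs => ⟨hs.1, (ENNReal.ofReal_le_iff_le_toReal hb).1 hs.2⟩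
      _ = b := by rw [Real.volume_Ioc, sub_zero, ENNReal.ofReal_toReal hb]

theorem rpow_eq_lintegral_Ioo {θ : ℝ} (hθ : 0 < θ) {a : ℝ≥0∞} (ha : a ≠ ∞) :
    a ^ θ = ∫⁻ t in Set.Ioi (0 : ℝ), {t : ℝ | ENNReal.ofReal t < a}.indicator
      (fun t => ENNReal.ofReal (θ * t ^ (θ - 1))) t := by
  have hset : {t : ℝ | ENNReal.ofReal t < a} ∩ Set.Ioi 0 = Set.Ioo 0 a.toReal := by
    ext t
    simp only [Set.mem_inter_iff, Set.mem_ofPred_eq, Set.mem_Ioi, Set.mem_Ioo]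
    exact ⟨fun h => ⟨h.2, (ENNReal.ofReal_lt_iff_lt_toReal h.2.le ha).1 h.1⟩,
      fun h => ⟨(ENNReal.ofReal_lt_iff_lt_toReal h.1.le ha).2 h.2, h.1⟩⟩
  have hmeas : MeasurableSet {t : ℝ | ENNReal.ofReal t < a} :=
    measurableSet_lt ENNReal.measurable_ofReal measurable_const
  rw [lintegral_indicator hmeas, Measure.restrict_restrict hmeas, hset,
    ← ofReal_integral_eq_lintegral_ofReal]
  · rw [← integral_Ioc_eq_integral_Ioo, ← intervalIntegral.integral_of_le ENNReal.toReal_nonneg,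
      intervalIntegral.integral_const_mul, integral_rpow (Or.inl (by linarith))]
    rw [sub_add_cancel, Real.zero_rpow hθ.ne', sub_zero, mul_div_cancel₀ _ hθ.ne',
      ENNReal.toReal_rpow, ENNReal.ofReal_toReal (ENNReal.rpow_ne_top_of_nonneg hθ.le ha)]
  · have := (intervalIntegral.intervalIntegrable_rpow' (a := 0) (b := a.toReal)
      (r := θ - 1) (by linarith)).const_mul θ
    rw [intervalIntegrable_iff_integrableOn_Ioo_of_le ENNReal.toReal_nonneg] at this
    exact this
  · filter_upwards [ae_restrict_mem measurableSet_Ioo] with t ht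
    exact mul_nonneg hθ.le (Real.rpow_nonneg ht.1.le _)

/-- The Lorentz norm `L^{p,1}` controls the integral of the distribution function to the power
`1 / p`. -/
theorem lintegral_distribution_rpow_le_lorentzNorm {α : Type*} [MeasurableSpace α]
    (g : α → ℝ) {p : ℝ} (hp : 0 < p) (μ : Measure α) [IsFiniteMeasure μ] :
    ∫⁻ s in Set.Ioi (0 : ℝ), μ {x | ENNReal.ofReal s < ‖g x‖ₑ} ^ (1 / p) ≤
      ENNReal.ofReal (1 / p) * lorentzNorm g p 1 μ := by
  set m : ℝ → ℝ≥0∞ := fun s => μ {x | ENNReal.ofReal s < ‖g x‖ₑ} with hm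
  -- Monotonicity makes `m` measurable even when `g` is not.
  have hanti : Antitone m := fun s t hst =>
    measure_mono fun x (hx : _ < _) => (ENNReal.ofReal_le_ofReal hst).trans_lt hx
  have hmm : Measurable m := hanti.measurable
  have hθ : 0 < 1 / p := by positivity
  set θ := 1 / p
  have hS : MeasurableSet {z : ℝ × ℝ | ENNReal.ofReal z.2 < m z.1} :=
    measurableSet_lt (ENNReal.measurable_ofReal.comp measurable_snd) (hmm.comp measurable_fst)
  have hF : Measurable (fun z : ℝ × ℝ => {z : ℝ × ℝ | ENNReal.ofReal z.2 < m z.1}.indicator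
      (fun z => ENNReal.ofReal (θ * z.2 ^ (θ - 1))) z) :=
    Measurable.indicator (by fun_prop) hS
  calc ∫⁻ s in Set.Ioi (0 : ℝ), m s ^ θ
      = ∫⁻ s in Set.Ioi (0 : ℝ), ∫⁻ t in Set.Ioi (0 : ℝ),
          {z : ℝ × ℝ | ENNReal.ofReal z.2 < m z.1}.indicator
            (fun z => ENNReal.ofReal (θ * z.2 ^ (θ - 1))) (s, t) := by
        refine lintegral_congr fun s => ?_
        rw [rpow_eq_lintegral_Ioo hθ (measure_ne_top _ _)]
        rfl
    _ = ∫⁻ t in Set.Ioi (0 : ℝ), ∫⁻ s in Set.Ioi (0 : ℝ),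
          {z : ℝ × ℝ | ENNReal.ofReal z.2 < m z.1}.indicator
            (fun z => ENNReal.ofReal (θ * z.2 ^ (θ - 1))) (s, t) :=
        lintegral_lintegral_swap hF.aemeasurable
    _ ≤ ∫⁻ t in Set.Ioi (0 : ℝ), ENNReal.ofReal θ *
          (ENNReal.ofReal (t ^ θ) * decreasingRearrangement g μ t / ENNReal.ofReal t) := by
        refine setLIntegral_mono' measurableSet_Ioi fun t (ht : 0 < t) => ?_
        have hmt : MeasurableSet {s : ℝ | ENNReal.ofReal t < m s} :=
          measurableSet_lt measurable_const hmm
        calc _ = ∫⁻ s in Set.Ioi (0 : ℝ), {s : ℝ | ENNReal.ofReal t < m s}.indicator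
                (fun _ => ENNReal.ofReal (θ * t ^ (θ - 1))) s := rfl
          _ = ENNReal.ofReal (θ * t ^ (θ - 1)) *
                volume ({s : ℝ | ENNReal.ofReal t < m s} ∩ Set.Ioi 0) := by
              rw [lintegral_indicator hmt, Measure.restrict_restrict hmt, setLIntegral_const]
          _ ≤ ENNReal.ofReal (θ * t ^ (θ - 1)) * decreasingRearrangement g μ t := by
              gcongr
              -- For fixed t, every s with t < m(s) satisfies s ≤ g*(t), so these s fill length at
              -- most g*(t).
              refine (measure_mono ?_).trans (volume_setOf_ofReal_le_le _)
              rintro s ⟨hs, hs0⟩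
              refine ⟨hs0, not_lt.1 fun hlt => ?_⟩
              exact (measure_lt_le_of_decreasingRearrangement_lt hlt).not_gt hs
          _ = _ := by
              rw [Real.rpow_sub_one ht.ne', ENNReal.ofReal_mul hθ.le,
                ENNReal.ofReal_div_of_pos ht, mul_assoc]
              simp only [div_eq_mul_inv]
              ring
    _ = ENNReal.ofReal θ * lorentzNorm g p 1 μ := by
        rw [lintegral_const_mul' _ _ ENNReal.ofReal_ne_top]
        simp [lorentzNorm, θ]

/-- Duality between weak `L^p` and `L^{p',1}`. -/
theorem lintegral_mul_le_lorentzNorm {α : Type*} [MeasurableSpace α] {μ : Measure α}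
    {k : α → ℝ} (hk : Measurable k) (hk0 : ∀ y, 0 ≤ k y) {p : ℝ} (hp : 1 < p) {W : ℝ}
    (hW : 0 ≤ W) (hweak : ∀ s : ℝ, 0 < s → μ {y | s < k y} ≤ ENNReal.ofReal (W * s ^ (-p)))
    {Ω : Set α} (hΩ : MeasurableSet Ω) (hΩf : μ Ω ≠ ∞) {f g : α → ℝ} (hf : Measurable f)
    (hf0 : ∀ y, 0 ≤ f y) (hfg : ∀ y ∈ Ω, f y ≤ |g y|) (hfΩ : ∀ y ∉ Ω, f y = 0) :
    ∫⁻ y, ENNReal.ofReal (k y * f y) ∂μ ≤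
      ENNReal.ofReal ((1 + W / (p - 1)) * (1 - 1 / p)) *
        lorentzNorm g (1 / (1 - 1 / p)) 1 (μ.restrict Ω) := by
  have hp0 : 0 < p := by linarith
  have hθ : 0 < 1 - 1 / p := by
    rw [sub_pos, div_lt_one hp0]; exact hp
  have hp1 : 0 < p - 1 := by linarith
  have : IsFiniteMeasure (μ.restrict Ω) := ⟨by simpa using hΩf.lt_top⟩
  have hsub : ∀ s : ℝ, 0 < s → μ {y | s < f y} ≤
      (μ.restrict Ω) {y | ENNReal.ofReal s < ‖g y‖ₑ} := by
    intro s hs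
    rw [Measure.restrict_apply' hΩ]
    refine measure_mono fun y (hy : s < f y) => ?_
    have hyΩ : y ∈ Ω := by
      by_contra h
      rw [hfΩ y h] at hy
      exact hy.not_gt hs
    refine ⟨?_, hyΩ⟩
    have := hy.trans_le (hfg y hyΩ)
    rw [Set.mem_ofPred_eq, Real.enorm_eq_ofReal_abs]
    exact (ENNReal.ofReal_lt_ofReal_iff (hs.trans this)).2 this
  -- Layer cake for `f` with respect to the measure k dμ leaves integrals of `k` over superlevel
  -- sets of `f`.
  calc ∫⁻ y, ENNReal.ofReal (k y * f y) ∂μ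
      = ∫⁻ y, ENNReal.ofReal (f y) ∂(μ.withDensity fun y => ENNReal.ofReal (k y)) := by
        rw [lintegral_withDensity_eq_lintegral_mul _ hk.ennreal_ofReal hf.ennreal_ofReal]
        refine lintegral_congr fun y => ?_
        rw [Pi.mul_apply, ENNReal.ofReal_mul (hk0 y)]
    _ = ∫⁻ s in Set.Ioi (0 : ℝ), ∫⁻ y in {y | s < f y}, ENNReal.ofReal (k y) ∂μ := by
        rw [lintegral_eq_lintegral_meas_lt _ (Filter.Eventually.of_forall hf0) hf.aemeasurable]
        refine lintegral_congr fun s => ?_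
        rw [withDensity_apply _ (measurableSet_lt measurable_const hf)]
    _ ≤ ∫⁻ s in Set.Ioi (0 : ℝ), ENNReal.ofReal (1 + W / (p - 1)) *
          (μ.restrict Ω) {y | ENNReal.ofReal s < ‖g y‖ₑ} ^ (1 - 1 / p) := by
        refine setLIntegral_mono' measurableSet_Ioi fun s (hs : 0 < s) => ?_
        refine (setLIntegral_le_of_weak_type hk hk0 hp hW hweak
          (ne_top_of_le_ne_top (measure_ne_top _ _) (hsub s hs))).trans ?_
        exact mul_le_mul' le_rfl (ENNReal.rpow_le_rpow (hsub s hs) hθ.le)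
    _ ≤ _ := by
        rw [lintegral_const_mul' _ _ ENNReal.ofReal_ne_top, ENNReal.ofReal_mul (by positivity),
          mul_assoc]
        gcongr
        have := lintegral_distribution_rpow_le_lorentzNorm g (p := 1 / (1 - 1 / p))
          (by positivity) (μ.restrict Ω)
        rwa [one_div_one_div] at this

/-! ### Second derivatives along lines. -/

theorem IsLocalMax.second_deriv_nonpos {φ φ' : ℝ → ℝ} {a x : ℝ} (hmax : IsLocalMax φ x)
    (h1 : ∀ᶠ t in 𝓝 x, HasDerivAt φ (φ' t) t) (h2 : HasDerivAt φ' a x) : a ≤ 0 := by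
  by_contra! ha
  have hd : deriv φ =ᶠ[𝓝 x] φ' := h1.mono fun t ht => ht.deriv
  have hdd : deriv (deriv φ) x = a := by rw [hd.deriv_eq, h2.deriv]
  -- If a > 0, the point is also a local minimum, so φ is locally constant and a = 0.
  have hmin : IsLocalMin φ x := isLocalMin_of_deriv_deriv_pos (by rw [hdd]; exact ha)
    hmax.deriv_eq_zero h1.self_of_nhds.continuousAt
  have hconst : φ =ᶠ[𝓝 x] fun _ => φ x := by
    filter_upwards [hmax, hmin] with t h h' using le_antisymm h h'
  have : deriv (deriv φ) x = 0 := by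
    rw [(hconst.deriv).deriv_eq]
    simp
  exact ha.ne' (hdd.symm.trans this)

section LineDeriv
variable {E : Type*} [NormedAddCommGroup E] [InnerProductSpace ℝ E]

/-- `g` is differentiable near `x` on the line through `x` in direction `e`, with second derivative
`a` at `x`. -/
def HasSecondLineDerivAt (g : E → ℝ) (x e : E) (a : ℝ) : Prop :=
  ∃ φ' : ℝ → ℝ, (∀ᶠ t in 𝓝 (0 : ℝ), HasDerivAt (fun t : ℝ => g (x + t • e)) (φ' t) t) ∧
    HasDerivAt φ' a 0

theorem HasSecondLineDerivAt.add {g h : E → ℝ} {x e : E} {a b : ℝ}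
    (hg : HasSecondLineDerivAt g x e a) (hh : HasSecondLineDerivAt h x e b) :
    HasSecondLineDerivAt (fun y => g y + h y) x e (a + b) := by
  obtain ⟨φ, h1, h2⟩ := hg
  obtain ⟨ψ, h3, h4⟩ := hh
  exact ⟨fun t => φ t + ψ t, by filter_upwards [h1, h3] with t h h' using h.add h', h2.add h4⟩

theorem HasSecondLineDerivAt.const_mul {g : E → ℝ} {x e : E} {a : ℝ}
    (hg : HasSecondLineDerivAt g x e a) (c : ℝ) :
    HasSecondLineDerivAt (fun y => c * g y) x e (c * a) := by
  obtain ⟨φ, h1, h2⟩ := hg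
  exact ⟨fun t => c * φ t, by filter_upwards [h1] with t h using h.const_mul c, h2.const_mul c⟩

theorem hasDerivAt_add_smul (x e : E) (t : ℝ) : HasDerivAt (fun t : ℝ => x + t • e) e t := by
  simpa using ((hasDerivAt_id t).smul_const e).const_add x

theorem ContDiffAt.hasSecondLineDerivAt {g : E → ℝ} {x : E} (hg : ContDiffAt ℝ 2 g x) (e : E) :
    HasSecondLineDerivAt g x e (iteratedFDeriv ℝ 2 g x ![e, e]) := by
  have hlim : Tendsto (fun t : ℝ => x + t • e) (𝓝 0) (𝓝 x) := by
    have := (hasDerivAt_add_smul x e 0).continuousAt.tendsto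
    simpa using this
  refine ⟨fun t => fderiv ℝ g (x + t • e) e, ?_, ?_⟩
  · filter_upwards [hlim.eventually (hg.eventually (by simp))] with t ht
    exact (ht.differentiableAt (by simp)).hasFDerivAt.comp_hasDerivAt t (hasDerivAt_add_smul x e t)
  · have h1 : DifferentiableAt ℝ (fderiv ℝ g) x :=
      (hg.fderiv_right (m := 1) (by norm_num)).differentiableAt (by simp)
    have h2 : HasFDerivAt (fderiv ℝ g) (fderiv ℝ (fderiv ℝ g) x) (x + (0 : ℝ) • e) := by
      simpa using h1.hasFDerivAt
    have h3 : HasDerivAt (fun t : ℝ => fderiv ℝ g (x + t • e)) (fderiv ℝ (fderiv ℝ g) x e) 0 :=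
      h2.comp_hasDerivAt (0 : ℝ) (hasDerivAt_add_smul x e 0)
    rw [iteratedFDeriv_two_apply]
    exact (ContinuousLinearMap.apply ℝ ℝ e).hasFDerivAt.comp_hasDerivAt (0 : ℝ) h3

theorem hasDerivAt_norm_sq_line (x e : E) (t : ℝ) :
    HasDerivAt (fun t : ℝ => ‖x + t • e‖ ^ 2) (2 * inner ℝ (x + t • e) e) t :=
  (hasDerivAt_add_smul x e t).norm_sq

theorem hasDerivAt_inner_line (x e : E) (t : ℝ) :
    HasDerivAt (fun t : ℝ => inner ℝ (x + t • e) e) (‖e‖ ^ 2) t := by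
  have := (hasDerivAt_add_smul x e t).inner ℝ (hasDerivAt_const t e)
  simpa [real_inner_self_eq_norm_sq] using this

theorem hasSecondLineDerivAt_norm_sq (x e : E) :
    HasSecondLineDerivAt (fun y => ‖y‖ ^ 2) x e (2 * ‖e‖ ^ 2) :=
  ⟨_, Eventually.of_forall fun t => hasDerivAt_norm_sq_line x e t,
    (hasDerivAt_inner_line x e 0).const_mul 2⟩

theorem IsLocalMax.secondLineDeriv_nonpos {g : E → ℝ} {x e : E} {a : ℝ} (hmax : IsLocalMax g x)
    (hg : HasSecondLineDerivAt g x e a) : a ≤ 0 := by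
  obtain ⟨φ, h1, h2⟩ := hg
  refine IsLocalMax.second_deriv_nonpos (φ := fun t : ℝ => g (x + t • e)) ?_ h1 h2
  have hlim : Tendsto (fun t : ℝ => x + t • e) (𝓝 0) (𝓝 x) := by
    have := (hasDerivAt_add_smul x e 0).continuousAt.tendsto
    simpa using this
  have := hlim.eventually hmax
  simpa [IsLocalMax, IsMaxFilter] using this

end LineDeriv

/-! ### Differentiating the regularized potential. -/

theorem hasDerivAt_integral_mul_of_hasCompactSupport {E : Type*} [TopologicalSpace E]
    [MeasurableSpace E] [OpensMeasurableSpace E] {μ : Measure E}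
    [IsFiniteMeasureOnCompacts μ] {F F' : ℝ → E → ℝ} {f : E → ℝ} (hf : Continuous f)
    (hfs : HasCompactSupport f) (hF : ∀ t, Continuous (F t))
    (hF' : Continuous (fun z : ℝ × E => F' z.1 z.2))
    (hder : ∀ t y, HasDerivAt (fun t => F t y) (F' t y) t) (t₀ : ℝ) :
    HasDerivAt (fun t => ∫ y, F t y * f y ∂μ) (∫ y, F' t₀ y * f y ∂μ) t₀ := by
  obtain ⟨C, hC⟩ := ((isCompact_Icc (a := t₀ - 1) (b := t₀ + 1)).prod hfs.isCompact)
    |>.exists_bound_of_continuousOn hF'.continuousOn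
  have hint : ∀ G : E → ℝ, Continuous G → Integrable (fun y => G y * f y) μ := fun G hG =>
    (hG.mul hf).integrable_of_hasCompactSupport hfs.mul_left
  refine (hasDerivAt_integral_of_dominated_loc_of_deriv_le (F := fun t y => F t y * f y)
    (F' := fun t y => F' t y * f y) (bound := fun y => C * |f y|)
    (Icc_mem_nhds (a := t₀ - 1) (b := t₀ + 1) (by linarith) (by linarith)) ?_ (hint _ (hF _))
    (hint _ (hF'.comp (by fun_prop : Continuous fun y : E => (t₀, y)))).aestronglyMeasurable
    ?_ ?_ ?_).2
  · exact Eventually.of_forall fun t => (hint _ (hF t)).aestronglyMeasurable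
  · refine Eventually.of_forall fun y t ht => ?_
    rw [norm_mul, Real.norm_eq_abs (f y)]
    by_cases hy : y ∈ tsupport f
    · gcongr
      exact hC (t, y) ⟨ht, hy⟩
    · simp [image_eq_zero_of_notMem_tsupport hy]
  · exact ((hf.integrable_of_hasCompactSupport hfs).abs).const_mul C
  · exact Eventually.of_forall fun y t _ => (hder t y).mul_const (f y)

section RegularizedKernel
variable {E : Type*} [NormedAddCommGroup E] [InnerProductSpace ℝ E]

/-- Second directional derivative of the potential `∫ (‖x - y‖² + ε²) ^ m f(y) dy`. -/
theorem hasSecondLineDerivAt_potential [MeasurableSpace E] [BorelSpace E] {μ : Measure E}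
    [IsFiniteMeasureOnCompacts μ] {f : E → ℝ} (hf : Continuous f)
    (hfs : HasCompactSupport f) (m : ℝ) {ε : ℝ} (hε : 0 < ε) (x e : E) :
    HasSecondLineDerivAt (fun x => ∫ y, (‖x - y‖ ^ 2 + ε ^ 2) ^ m * f y ∂μ) x e
      (∫ y, (4 * m * (m - 1) * (‖x - y‖ ^ 2 + ε ^ 2) ^ (m - 2) * inner ℝ (x - y) e ^ 2 +
        2 * m * (‖x - y‖ ^ 2 + ε ^ 2) ^ (m - 1) * ‖e‖ ^ 2) * f y ∂μ) := by
  have hpos : ∀ z : E, ‖z‖ ^ 2 + ε ^ 2 ≠ 0 := fun z => by positivity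
  have hq : ∀ (t : ℝ) (y : E) (r : ℝ), HasDerivAt
      (fun t : ℝ => (‖(x - y) + t • e‖ ^ 2 + ε ^ 2) ^ r)
      (2 * inner ℝ ((x - y) + t • e) e * r * (‖(x - y) + t • e‖ ^ 2 + ε ^ 2) ^ (r - 1)) t :=
    fun t y r => ((hasDerivAt_norm_sq_line (x - y) e t).add_const _).rpow_const (Or.inl (hpos _))
  have hcont : ∀ (r : ℝ), Continuous
      (fun z : ℝ × E => (‖(x - z.2) + z.1 • e‖ ^ 2 + ε ^ 2) ^ r) := fun r =>
    Continuous.rpow_const (by fun_prop) fun z => Or.inl (hpos _)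
  have hpair : ∀ t : ℝ, Continuous (fun y : E => (t, y)) := fun t => by fun_prop
  have hc1 : Continuous (fun z : ℝ × E => 2 * inner ℝ ((x - z.2) + z.1 • e) e * m *
      (‖(x - z.2) + z.1 • e‖ ^ 2 + ε ^ 2) ^ (m - 1)) :=
    Continuous.mul (by fun_prop) (hcont _)
  refine ⟨fun t => ∫ y, 2 * inner ℝ ((x - y) + t • e) e * m *
    (‖(x - y) + t • e‖ ^ 2 + ε ^ 2) ^ (m - 1) * f y ∂μ, Eventually.of_forall fun t => ?_, ?_⟩
  · have := hasDerivAt_integral_mul_of_hasCompactSupport (μ := μ)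
      (F := fun t y => (‖(x - y) + t • e‖ ^ 2 + ε ^ 2) ^ m) hf hfs
      (fun t => (hcont m).comp (hpair t)) hc1 (fun t y => hq t y m) t
    simpa only [sub_add_eq_add_sub] using this
  · have := hasDerivAt_integral_mul_of_hasCompactSupport (μ := μ)
      (F := fun t y => 2 * inner ℝ ((x - y) + t • e) e * m *
        (‖(x - y) + t • e‖ ^ 2 + ε ^ 2) ^ (m - 1))
      (F' := fun t y => 2 * ‖e‖ ^ 2 * m * (‖(x - y) + t • e‖ ^ 2 + ε ^ 2) ^ (m - 1) +
        2 * inner ℝ ((x - y) + t • e) e * m * (2 * inner ℝ ((x - y) + t • e) e * (m - 1) *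
          (‖(x - y) + t • e‖ ^ 2 + ε ^ 2) ^ (m - 1 - 1))) hf hfs
      (fun t => hc1.comp (hpair t))
      ((Continuous.mul (by fun_prop) (hcont _)).add
        (Continuous.mul (by fun_prop) (Continuous.mul (by fun_prop) (hcont _))))
      (fun t y => ((((hasDerivAt_inner_line (x - y) e t).const_mul 2).mul_const m).mul
        (hq t y (m - 1)))) 0
    convert this using 3 with y
    rw [zero_smul, add_zero, sub_sub m 1 1, one_add_one_eq_two]
    ring

end RegularizedKernel

/-! ### The regularized Newtonian kernel. -/

section EuclideanKernel
variable {n : ℕ}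

/-- The kernel is at most |x - y|^(2-n), so the superlevel set lies in a ball of radius
s^(-1/(n-2)); the bound is uniform in ε and x. -/
theorem volume_superlevel_regularized_kernel_le (hn : 3 ≤ n) {ε : ℝ}
    (x : EuclideanSpace ℝ (Fin n)) {s : ℝ} (hs : 0 < s) :
    volume {y : EuclideanSpace ℝ (Fin n) | s < (‖x - y‖ ^ 2 + ε ^ 2) ^ ((2 - n : ℝ) / 2)} ≤
      ENNReal.ofReal ((volume (Metric.ball (0 : EuclideanSpace ℝ (Fin n)) 1)).toReal *
        s ^ (-(n / (n - 2) : ℝ))) := by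
  have hn2 : (0 : ℝ) < n - 2 := by
    have : (3 : ℝ) ≤ n := by exact_mod_cast hn
    linarith
  have : Nonempty (Fin n) := ⟨⟨0, by omega⟩⟩
  set r : ℝ := s ^ (-(1 / (n - 2)) : ℝ) with hr
  have hr0 : 0 < r := Real.rpow_pos_of_pos hs _
  have hsub : {y : EuclideanSpace ℝ (Fin n) | s < (‖x - y‖ ^ 2 + ε ^ 2) ^ ((2 - n : ℝ) / 2)} ⊆
      Metric.ball x r := by
    intro y hy
    by_contra hyr
    rw [Metric.mem_ball, not_lt, dist_comm, dist_eq_norm] at hyr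
    refine (lt_irrefl s) (lt_of_lt_of_le hy ?_)
    calc (‖x - y‖ ^ 2 + ε ^ 2) ^ ((2 - n : ℝ) / 2) ≤ (r ^ 2) ^ ((2 - n : ℝ) / 2) := by
          refine Real.rpow_le_rpow_of_nonpos (by positivity) ?_ (by linarith)
          have := pow_le_pow_left₀ hr0.le hyr 2
          nlinarith [sq_nonneg ε]
      _ = s := by
          rw [hr, ← Real.rpow_natCast, ← Real.rpow_mul hs.le, ← Real.rpow_mul hs.le]
          convert Real.rpow_one s using 2
          field_simp
          push_cast
          ring
  refine (measure_mono hsub).trans (le_of_eq ?_)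
  rw [Measure.addHaar_ball _ _ hr0.le, mul_comm, ENNReal.ofReal_mul ENNReal.toReal_nonneg,
    ENNReal.ofReal_toReal measure_ball_lt_top.ne, finrank_euclideanSpace, Fintype.card_fin, hr,
    ← Real.rpow_natCast, ← Real.rpow_mul hs.le]
  congr 3
  field_simp

/-- Minus the Laplacian of the potential `∫ (‖x - y‖² + ε²) ^ ((2 - n) / 2) f(y) dy` approximates
a multiple of `f` from above. -/
theorem exists_le_integral_kernel (hn : 3 ≤ n) {f : EuclideanSpace ℝ (Fin n) → ℝ}
    (hf : Continuous f) (hfs : HasCompactSupport f) (hf0 : ∀ y, 0 ≤ f y) {η : ℝ} (hη : 0 < η) :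
    ∃ ε : ℝ, 0 < ε ∧ ∀ x, n * (n - 2) * 2 ^ (-(n + 2) / 2 : ℝ) *
        (volume (Metric.ball (0 : EuclideanSpace ℝ (Fin n)) 1)).toReal * (f x - η) ≤
      ∫ y, n * (n - 2) * ε ^ 2 * (‖x - y‖ ^ 2 + ε ^ 2) ^ (-(n + 2) / 2 : ℝ) * f y := by
  have hn2 : (0 : ℝ) < n - 2 := by
    have : (3 : ℝ) ≤ n := by exact_mod_cast hn
    linarith
  have : Nonempty (Fin n) := ⟨⟨0, by omega⟩⟩
  obtain ⟨δ, hδ, huc⟩ := Metric.uniformContinuous_iff.1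
    (hf.uniformContinuous_of_tendsto_cocompact hfs.is_zero_at_infty) η hη
  -- The regularization scale is the modulus of uniform continuity: on the ball of radius δ about x,
  -- f exceeds f(x) - η and |x - y|² + δ² ≤ 2δ², the source of the power of 2.
  refine ⟨δ, hδ, fun x => ?_⟩
  set k : EuclideanSpace ℝ (Fin n) → ℝ := fun y =>
    n * (n - 2) * δ ^ 2 * (‖x - y‖ ^ 2 + δ ^ 2) ^ (-(n + 2) / 2 : ℝ) with hk
  have hk0 : ∀ y, 0 ≤ k y := fun y => by positivity
  have hkc : Continuous k := by
    refine Continuous.mul continuous_const (Continuous.rpow_const (by fun_prop) fun y => Or.inl ?_)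
    positivity
  have hkf : Integrable (fun y => k y * f y) :=
    (hkc.mul hf).integrable_of_hasCompactSupport hfs.mul_left
  rcases le_or_gt (f x - η) 0 with hle | hlt
  · refine (mul_nonpos_of_nonneg_of_nonpos (by positivity) hle).trans ?_
    exact integral_nonneg fun y => mul_nonneg (hk0 y) (hf0 y)
  set K : ℝ := n * (n - 2) * δ ^ 2 * (2 * δ ^ 2) ^ (-(n + 2) / 2 : ℝ)
  have hKk : ∀ y ∈ Metric.ball x δ, K * (f x - η) ≤ k y * f y := by
    intro y hy
    have hd := huc hy
    rw [Real.dist_eq, abs_lt] at hd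
    refine mul_le_mul ?_ (by linarith) hlt.le (hk0 y)
    refine mul_le_mul_of_nonneg_left ?_ (by positivity)
    refine Real.rpow_le_rpow_of_nonpos (by positivity) ?_ (by linarith)
    rw [Metric.mem_ball, dist_comm, dist_eq_norm] at hy
    nlinarith [norm_nonneg (x - y)]
  calc _ = ∫ y in Metric.ball x δ, K * (f x - η) := by
        rw [setIntegral_const, measureReal_def, Measure.addHaar_ball _ _ hδ.le,
          finrank_euclideanSpace, Fintype.card_fin, ENNReal.toReal_mul,
          ENNReal.toReal_ofReal (by positivity), smul_eq_mul]
        -- Scale invariance: all powers of δ cancel, so the constant does not depend on `f` or `η`.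
        have h1 : (2 * δ ^ 2) ^ (-(n + 2) / 2 : ℝ) * δ ^ 2 * δ ^ n = 2 ^ (-(n + 2) / 2 : ℝ) := by
          rw [Real.mul_rpow (by norm_num) (by positivity), ← Real.rpow_natCast δ 2,
            ← Real.rpow_natCast δ n, ← Real.rpow_mul hδ.le, mul_assoc, mul_assoc,
            ← Real.rpow_add hδ, ← Real.rpow_add hδ]
          convert mul_one _
          convert Real.rpow_zero δ
          push_cast
          ring
        rw [← h1]
        ring
    _ ≤ ∫ y in Metric.ball x δ, k y * f y :=
        setIntegral_mono_on (integrableOn_const measure_ball_lt_top.ne) hkf.integrableOn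
          measurableSet_ball hKk
    _ ≤ ∫ y, k y * f y :=
        setIntegral_le_integral hkf (Eventually.of_forall fun y => mul_nonneg (hk0 y) (hf0 y))

/-- The Laplacian of the regularized Newtonian potential, as a sum of directional derivatives. -/
theorem sum_second_derivative_potential {ι : Type*} [Fintype ι] {f : EuclideanSpace ℝ (Fin n) → ℝ}
    (hf : Continuous f) (hfs : HasCompactSupport f) {ε : ℝ} (hε : 0 < ε)
    (b : OrthonormalBasis ι ℝ (EuclideanSpace ℝ (Fin n))) (x : EuclideanSpace ℝ (Fin n)) (m : ℝ)
    (hm : m = (2 - n) / 2) :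
    ∑ i, ∫ y, (4 * m * (m - 1) * (‖x - y‖ ^ 2 + ε ^ 2) ^ (m - 2) * inner ℝ (x - y) (b i) ^ 2 +
        2 * m * (‖x - y‖ ^ 2 + ε ^ 2) ^ (m - 1) * ‖b i‖ ^ 2) * f y =
      -∫ y, n * (n - 2) * ε ^ 2 * (‖x - y‖ ^ 2 + ε ^ 2) ^ (-(n + 2) / 2 : ℝ) * f y := by
  have hpos : ∀ y, 0 < ‖x - y‖ ^ 2 + ε ^ 2 := fun y => by positivity
  have hc : ∀ r : ℝ, Continuous fun y => (‖x - y‖ ^ 2 + ε ^ 2) ^ r := fun r =>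
    Continuous.rpow_const (by fun_prop) fun y => Or.inl (hpos y).ne'
  have hcard : (Fintype.card ι : ℝ) = n := by
    rw [← Module.finrank_eq_card_basis b.toBasis, finrank_euclideanSpace, Fintype.card_fin]
  rw [← integral_finsetSum, ← integral_neg]
  · refine integral_congr_ae (Eventually.of_forall fun y => ?_)
    simp only [← Finset.sum_mul, Finset.sum_add_distrib, ← Finset.mul_sum, b.sum_sq_inner_left,
      b.norm_eq_one, one_pow, Finset.sum_const, Finset.card_univ, nsmul_eq_mul, mul_one, hcard]
    -- Since 4(m - 1) + 2n = 0, the terms in |x - y|² cancel and only 2mnε² = -n(n-2)ε² remains.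
    rw [show (‖x - y‖ ^ 2 + ε ^ 2) ^ (m - 1) =
        (‖x - y‖ ^ 2 + ε ^ 2) ^ (m - 2) * (‖x - y‖ ^ 2 + ε ^ 2) by
      rw [← Real.rpow_add_one (hpos y).ne']; congr 1; ring]
    rw [show (-(n + 2) / 2 : ℝ) = m - 2 by rw [hm]; ring, hm]
    ring
  · intro i _
    refine (Continuous.mul ?_ hf).integrable_of_hasCompactSupport hfs.mul_left
    have := hc (m - 2)
    have := hc (m - 1)
    fun_prop

/-- The regularized Newtonian potential is bounded by the Lorentz norm. -/
theorem ofReal_potential_le_lorentzNorm (hn : 3 ≤ n) {Ω : Set (EuclideanSpace ℝ (Fin n))}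
    (hΩ : IsOpen Ω) (hb : Bornology.IsBounded Ω) {f g : EuclideanSpace ℝ (Fin n) → ℝ}
    (hf : Continuous f) (hfs : HasCompactSupport f) (hf0 : ∀ y, 0 ≤ f y)
    (hfg : ∀ y ∈ Ω, f y ≤ |g y|) (hfΩ : ∀ y ∉ Ω, f y = 0) {ε : ℝ} (hε : 0 < ε)
    (x : EuclideanSpace ℝ (Fin n)) :
    ENNReal.ofReal (∫ y, (‖x - y‖ ^ 2 + ε ^ 2) ^ ((2 - n : ℝ) / 2) * f y) ≤
      ENNReal.ofReal ((1 + (volume (Metric.ball (0 : EuclideanSpace ℝ (Fin n)) 1)).toReal /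
        (n / (n - 2) - 1)) * (1 - 1 / (n / (n - 2)))) *
        lorentzNorm g ((n : ℝ) / 2) 1 (volume.restrict Ω) := by
  have hn3 : (3 : ℝ) ≤ n := by exact_mod_cast hn
  have hn2 : (0 : ℝ) < n - 2 := by linarith
  have hkc : Continuous fun y => (‖x - y‖ ^ 2 + ε ^ 2) ^ ((2 - n : ℝ) / 2) :=
    Continuous.rpow_const (by fun_prop) fun y => Or.inl (by positivity)
  have := lintegral_mul_le_lorentzNorm (μ := volume) (p := n / (n - 2)) hkc.measurable
    (fun y => by positivity) (by rw [lt_div_iff₀ hn2]; linarith) ENNReal.toReal_nonneg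
    (fun s hs => volume_superlevel_regularized_kernel_le hn (ε := ε) x hs) hΩ.measurableSet
    hb.measure_lt_top.ne hf.measurable hf0 hfg hfΩ
  rw [show (1 / (1 - 1 / (n / (n - 2))) : ℝ) = n / 2 by field_simp; ring] at this
  refine le_trans (le_of_eq ?_) this
  rw [ofReal_integral_eq_lintegral_ofReal]
  · exact (hkc.mul hf).integrable_of_hasCompactSupport hfs.mul_left
  · exact Eventually.of_forall fun y => mul_nonneg (by positivity) (hf0 y)

end EuclideanKernel

/-! ### Continuity of the potential and of the Laplacian. -/

theorem continuous_potential {E : Type*} [NormedAddCommGroup E] [InnerProductSpace ℝ E]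
    [FiniteDimensional ℝ E] [MeasurableSpace E] [BorelSpace E] {μ : Measure E}
    [IsFiniteMeasureOnCompacts μ] {f : E → ℝ} (hf : Continuous f) (hfs : HasCompactSupport f)
    (m : ℝ) {ε : ℝ} (hε : 0 < ε) :
    Continuous fun x => ∫ y, (‖x - y‖ ^ 2 + ε ^ 2) ^ m * f y ∂μ := by
  have hc : Continuous (Function.uncurry fun x y : E => (‖x - y‖ ^ 2 + ε ^ 2) ^ m * f y) := by
    refine Continuous.mul (Continuous.rpow_const (by fun_prop) fun z => Or.inl ?_) (by fun_prop)
    positivity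
  have := continuous_parametric_integral_of_continuous (μ := μ) hc hfs.isCompact
  convert this using 2 with x
  refine (setIntegral_eq_integral_of_forall_compl_eq_zero fun y hy => ?_).symm
  rw [image_eq_zero_of_notMem_tsupport hy, mul_zero]

theorem ContDiffOn.continuousOn_laplacian {E : Type*} [NormedAddCommGroup E]
    [InnerProductSpace ℝ E] [FiniteDimensional ℝ E] {u : E → ℝ} {Ω : Set E} (hΩ : IsOpen Ω)
    (hu : ContDiffOn ℝ 2 u Ω) : ContinuousOn (Laplacian.laplacian u) Ω := by
  rw [InnerProductSpace.laplacian_eq_iteratedFDeriv_stdOrthonormalBasis]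
  refine continuousOn_finsetSum _ fun i _ => ?_
  have h : ContinuousOn (iteratedFDeriv ℝ 2 u) Ω :=
    (hu.continuousOn_iteratedFDerivWithin le_rfl hΩ.uniqueDiffOn).congr
      fun x hx => (iteratedFDerivWithin_of_isOpen 2 hΩ hx).symm
  intro x hx
  exact ((ContinuousMultilinearMap.apply ℝ (fun _ : Fin 2 => E) ℝ _).continuous.continuousAt.comp
    (h.continuousAt (hΩ.mem_nhds hx))).continuousWithinAt

/-! ### Comparison by the maximum principle. -/

/-- One-sided maximum estimate, given a uniform bound `B` for the regularized potentials of
truncations of `|Δ u|`. -/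
theorem sub_le_of_potential_bound {n : ℕ} (hn : 3 ≤ n) {Ω : Set (EuclideanSpace ℝ (Fin n))}
    (hΩ : IsOpen Ω) (hb : Bornology.IsBounded Ω) {u : EuclideanSpace ℝ (Fin n) → ℝ}
    (hu : ContDiffOn ℝ 2 u Ω) (huc : ContinuousOn u (closure Ω)) {M B : ℝ}
    (hM : ∀ x ∈ frontier Ω, u x ≤ M)
    (hB : ∀ f : EuclideanSpace ℝ (Fin n) → ℝ, Continuous f → HasCompactSupport f →
      (∀ y, 0 ≤ f y) → (∀ y ∈ Ω, f y ≤ |Laplacian.laplacian u y|) → (∀ y ∉ Ω, f y = 0) →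
      ∀ ε : ℝ, 0 < ε → ∀ x, ∫ y, (‖x - y‖ ^ 2 + ε ^ 2) ^ ((2 - n : ℝ) / 2) * f y ≤ B)
    {κ : ℝ} (hκ : κ = n * (n - 2) * 2 ^ (-(n + 2) / 2 : ℝ) *
        (volume (Metric.ball (0 : EuclideanSpace ℝ (Fin n)) 1)).toReal) (hκ0 : 0 < κ)
    {x : EuclideanSpace ℝ (Fin n)} (hx : x ∈ Ω) : u x ≤ M + B / κ := by
  have hn3 : (3 : ℝ) ≤ n := by exact_mod_cast hn
  obtain ⟨R, hR⟩ := hb.closure.exists_norm_le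
  have hB0 : 0 ≤ B := by
    have := hB (fun _ => 0) continuous_const HasCompactSupport.zero (by simp) (by simp) (by simp)
      1 one_pos x
    simpa using this
  -- One parameter ρ serves as gap above the boundary level, as the error in
  -- `exists_le_integral_kernel`, and as the coefficient of the strictly subharmonic term.
  suffices H : ∀ ρ : ℝ, 0 < ρ → u x ≤ M + B / κ + ρ * (1 + R ^ 2) by
    refine le_of_forall_pos_le_add fun δ hδ => ?_
    have hR1 : 0 < 1 + R ^ 2 := by positivity
    have := H (δ / (1 + R ^ 2)) (by positivity)
    rwa [div_mul_cancel₀ _ hR1.ne'] at this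
  intro ρ hρ
  set K : Set (EuclideanSpace ℝ (Fin n)) := {y ∈ closure Ω | M + ρ ≤ u y} with hK
  have hKcl : IsClosed K := by
    have : K = closure Ω ∩ u ⁻¹' Set.Ici (M + ρ) := rfl
    rw [this]
    exact huc.preimage_isClosed_of_isClosed isClosed_closure isClosed_Ici
  have hKc : IsCompact K :=
    hb.isCompact_closure.of_isClosed_subset hKcl fun y hy => hy.1
  have hKΩ : K ⊆ Ω := by
    intro y hy
    by_contra hyΩ
    have : y ∈ frontier Ω := by rw [hΩ.frontier_eq]; exact ⟨hy.1, hyΩ⟩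
    linarith [hM y this, hy.2]
  by_cases hxK : M + ρ ≤ u x
  swap
  · have : 0 ≤ B / κ := by positivity
    nlinarith [mul_nonneg hρ.le (sq_nonneg R)]
  have hxK : x ∈ K := ⟨subset_closure hx, hxK⟩
  -- Δu may blow up at the boundary; the cutoff makes the density continuous and compactly
  -- supported, yet equal to |Δu| on `K`.
  obtain ⟨χ, hχs, hχK, hχ01⟩ := exists_tsupport_one_of_isOpen_isClosed hΩ hb.isCompact_closure
    hKcl hKΩ
  have hχ : ∀ y ∉ Ω, χ y = 0 := fun y hy =>
    image_eq_zero_of_notMem_tsupport fun h => hy (hχs h)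
  set f : EuclideanSpace ℝ (Fin n) → ℝ := fun y => χ y * |Laplacian.laplacian u y| with hf
  have hts : tsupport f ⊆ tsupport χ := tsupport_mul_subset_left
  have hfc : Continuous f := by
    refine continuous_of_tsupport fun y hy => ?_
    have hyΩ := hχs (hts hy)
    exact χ.continuous.continuousAt.mul
      ((hu.continuousOn_laplacian hΩ).continuousAt (hΩ.mem_nhds hyΩ)).abs
  have hfs : HasCompactSupport f :=
    hb.isCompact_closure.of_isClosed_subset (isClosed_tsupport f)
      ((hts.trans hχs).trans subset_closure)
  have hf0 : ∀ y, 0 ≤ f y := fun y => mul_nonneg (hχ01 y).1 (abs_nonneg _)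
  obtain ⟨ε, hε, hI⟩ := exists_le_integral_kernel hn hfc hfs hf0 hρ
  rw [← hκ] at hI
  set w : EuclideanSpace ℝ (Fin n) → ℝ := fun x =>
    ∫ y, (‖x - y‖ ^ 2 + ε ^ 2) ^ ((2 - n : ℝ) / 2) * f y with hw
  have hwB : ∀ y, w y ≤ B := hB f hfc hfs hf0
    (fun y _ => mul_le_of_le_one_left (abs_nonneg _) (hχ01 y).2)
    (fun y hy => by simp [f, hχ y hy]) ε hε
  have hw0 : ∀ y, 0 ≤ w y := fun y =>
    integral_nonneg fun z => mul_nonneg (by positivity) (hf0 z)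
  have hwc : Continuous w := continuous_potential hfc hfs _ hε
  set g : EuclideanSpace ℝ (Fin n) → ℝ := fun y => u y + (-(1 / κ)) * w y + ρ * ‖y‖ ^ 2 with hg
  have hgc : ContinuousOn g K :=
    ((huc.mono fun y hy => hy.1).add (hwc.const_mul _ |>.continuousOn)).add
      (by fun_prop)
  obtain ⟨z, hzK, hzmax⟩ := hKc.exists_isMaxOn ⟨x, hxK⟩ hgc
  have hzΩ := hKΩ hzK
  -- Where u > M + ρ, a maximum over `K` is a genuine local maximum, so Δu + I/κ + 2nρ ≤ 0 with I =
  -- -Δw. But I/κ ≥ |Δu| - ρ, and 2n > 1 gives a contradiction.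
  have hz : u z = M + ρ := by
    by_contra hne
    have hlt : M + ρ < u z := lt_of_le_of_ne hzK.2 (Ne.symm hne)
    have huz : ContinuousAt u z := (hu.contDiffAt (hΩ.mem_nhds hzΩ)).continuousAt
    have hloc : IsLocalMax g z := by
      filter_upwards [huz.eventually (lt_mem_nhds hlt), hΩ.mem_nhds hzΩ] with y hy hyΩ
      exact hzmax ⟨subset_closure hyΩ, hy.le⟩
    set b := stdOrthonormalBasis ℝ (EuclideanSpace ℝ (Fin n))
    have hsum := Finset.sum_nonpos fun i (_ : i ∈ Finset.univ) => hloc.secondLineDeriv_nonpos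
      ((((hu.contDiffAt (hΩ.mem_nhds hzΩ)).hasSecondLineDerivAt (b i)).add
        ((hasSecondLineDerivAt_potential (μ := volume) hfc hfs ((2 - n : ℝ) / 2) hε z
          (b i)).const_mul (-(1 / κ)))).add ((hasSecondLineDerivAt_norm_sq z (b i)).const_mul ρ))
    rw [Finset.sum_add_distrib, Finset.sum_add_distrib, ← Finset.mul_sum, ← Finset.mul_sum,
      sum_second_derivative_potential hfc hfs hε b z _ rfl] at hsum
    simp only [b.norm_eq_one, one_pow, mul_one, Finset.sum_const, Finset.card_univ, nsmul_eq_mul,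
      Fintype.card_fin, finrank_euclideanSpace] at hsum
    have hlap : Laplacian.laplacian u z = ∑ i, iteratedFDeriv ℝ 2 u z ![b i, b i] :=
      congrFun (InnerProductSpace.laplacian_eq_iteratedFDeriv_stdOrthonormalBasis u) z
    rw [← hlap] at hsum
    have hfz : f z = |Laplacian.laplacian u z| := by simp [f, hχK hzK]
    have h1 := hI z
    rw [hfz, mul_comm, ← le_div_iff₀ hκ0] at h1
    rw [neg_mul_neg, one_div_mul_eq_div] at hsum
    nlinarith [neg_abs_le (Laplacian.laplacian u z)]
  have h1 : g x ≤ g z := hzmax hxK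
  simp only [hg, hz] at h1
  have h2 : 1 / κ * w x ≤ B / κ := by
    rw [one_div_mul_eq_div]; gcongr; exact hwB x
  have h3 : 0 ≤ 1 / κ * w z := mul_nonneg (by positivity) (hw0 z)
  have h4 : ‖z‖ ^ 2 ≤ R ^ 2 := by
    gcongr; exact hR z hzK.1
  nlinarith [mul_nonneg hρ.le (sq_nonneg ‖x‖), mul_le_mul_of_nonneg_left h4 hρ.le]

/-! ### The two-sided estimate. -/

theorem theorem1 (n : ℕ) (hn : 3 ≤ n) :
    ∃ c : ℝ≥0, 0 < c ∧
      ∀ (Ω : Set (EuclideanSpace ℝ (Fin n))) (u : EuclideanSpace ℝ (Fin n) → ℝ),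
        IsOpen Ω → Bornology.IsBounded Ω →
        ContDiffOn ℝ 2 u Ω → ContinuousOn u (closure Ω) →
        (⨆ x ∈ Ω, ‖u x‖ₑ) ≤
          (⨆ x ∈ frontier Ω, ‖u x‖ₑ) +
            (c : ℝ≥0∞) * lorentzNorm (Laplacian.laplacian u) ((n : ℝ) / 2) 1 (volume.restrict Ω) := by
  have hn3 : (3 : ℝ) ≤ n := by exact_mod_cast hn
  have hn2 : (0 : ℝ) < n - 2 := by linarith
  set V := (volume (Metric.ball (0 : EuclideanSpace ℝ (Fin n)) 1)).toReal with hV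
  have hV0 : 0 < V :=
    ENNReal.toReal_pos (Metric.measure_ball_pos _ _ one_pos).ne' measure_ball_lt_top.ne
  set C : ℝ := (1 + V / (n / (n - 2) - 1)) * (1 - 1 / (n / (n - 2))) with hC
  have hC0 : 0 < C := by
    have h1 : (1 : ℝ) < n / (n - 2) := by rw [lt_div_iff₀ hn2]; linarith
    have h2 : 1 / (n / (n - 2) : ℝ) < 1 := by rw [div_lt_one (by linarith)]; exact h1
    have h3 : (0 : ℝ) < n / (n - 2) - 1 := by linarith
    exact mul_pos (by positivity) (by linarith)
  set κ : ℝ := n * (n - 2) * 2 ^ (-(n + 2) / 2 : ℝ) * V with hκ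
  have hκ0 : 0 < κ := by positivity
  refine ⟨(C / κ).toNNReal, Real.toNNReal_pos.2 (by positivity), fun Ω u hΩ hb hu huc => ?_⟩
  set Λ := lorentzNorm (Laplacian.laplacian u) ((n : ℝ) / 2) 1 (volume.restrict Ω)
  set S := ⨆ x ∈ frontier Ω, ‖u x‖ₑ
  change _ ≤ S + ENNReal.ofReal (C / κ) * Λ
  rcases eq_or_ne S ∞ with hS | hS
  · simp [hS]
  rcases eq_or_ne Λ ∞ with hΛ | hΛ
  · rw [hΛ, ENNReal.mul_top (by simpa using by positivity)]
    simp
  have hM : ∀ x ∈ frontier Ω, |u x| ≤ S.toReal := fun x hx => by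
    rw [← ENNReal.ofReal_le_iff_le_toReal hS, ← Real.enorm_eq_ofReal_abs]
    exact le_iSup₂ (f := fun x (_ : x ∈ frontier Ω) => ‖u x‖ₑ) x hx
  have hB : ∀ f : EuclideanSpace ℝ (Fin n) → ℝ, Continuous f → HasCompactSupport f →
      (∀ y, 0 ≤ f y) → (∀ y ∈ Ω, f y ≤ |Laplacian.laplacian u y|) → (∀ y ∉ Ω, f y = 0) →
      ∀ ε : ℝ, 0 < ε → ∀ x, ∫ y, (‖x - y‖ ^ 2 + ε ^ 2) ^ ((2 - n : ℝ) / 2) * f y ≤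
        C * Λ.toReal := by
    intro f hf hfs hf0 hfg hfΩ ε hε x
    have := ofReal_potential_le_lorentzNorm hn hΩ hb hf hfs hf0 hfg hfΩ hε x
    rw [ENNReal.ofReal_le_iff_le_toReal (ENNReal.mul_ne_top ENNReal.ofReal_ne_top hΛ),
      ENNReal.toReal_mul, ENNReal.toReal_ofReal hC0.le] at this
    exact this
  refine iSup₂_le fun x hx => ?_
  have hpos := sub_le_of_potential_bound hn hΩ hb hu huc
    (fun y hy => (le_abs_self _).trans (hM y hy)) hB hκ hκ0 hx
  -- The potential bound depends only on |Δu|, so it also serves for -u.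
  have hneg := sub_le_of_potential_bound (u := -u) (M := S.toReal) hn hΩ hb hu.neg huc.neg
    (fun y hy => (neg_le_abs _).trans (hM y hy))
    (by simpa only [InnerProductSpace.laplacian_neg, Pi.neg_apply, abs_neg] using hB) hκ hκ0 hx
  rw [Real.enorm_eq_ofReal_abs]
  calc ENNReal.ofReal |u x| ≤ ENNReal.ofReal (S.toReal + C / κ * Λ.toReal) := by
        refine ENNReal.ofReal_le_ofReal (abs_le'.2 ⟨?_, ?_⟩)
        · rwa [div_mul_eq_mul_div]
        · rwa [div_mul_eq_mul_div]
    _ = S + ENNReal.ofReal (C / κ) * Λ := by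
        rw [ENNReal.ofReal_add ENNReal.toReal_nonneg (by positivity),
          ENNReal.ofReal_mul (by positivity), ENNReal.ofReal_toReal hS, ENNReal.ofReal_toReal hΛ]
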